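/- Let $p \ge 17$ be a prime and let $k \in \mathbb{F}_p$ be such that $2-k$ is a non-zero square in $\mathbb{F}_p$. Call $t \in \mathbb{F}_p$ \emph{hyperbolic} if $t^2-4$ is a non-zero square in $\mathbb{F}_p$. Then the equation \[ x^2+y^2+z^2-xyz-2 = k \] has at least $\frac{p}{16}$ solutions $(x,y,z) \in \mathbb{F}_p^3$ such that $x$ and $y$ are hyperbolic and $xy - z = z$. -/

import Mathlib

/-- An element `t` of a field is hyperbolic when `t ^ 2 - 4` is a non-zero square. -/
def IsHyperbolic {F : Type*} [Field F] (t : F) : Prop :=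
  t ^ 2 - 4 ≠ 0 ∧ IsSquare (t ^ 2 - 4)

/-- The set `M_k(F)` of triples `(x, y, z)` in `F` with `x² + y² + z² - xyz - 2 = k`. -/
def markoffSolutions {F : Type*} [Field F] (k : F) : Set (F × F × F) :=
  {(x, y, z) | x ^ 2 + y ^ 2 + z ^ 2 - x * y * z - 2 = k}

/-!
The relation `x * y - z = z` forces `z = x * y / 2`. Writing `2 - k = d ^ 2`, the Markoff-type
equation then becomes `(x ^ 2 - 4) * (y ^ 2 - 4) = 4 * d ^ 2`, so that `y` is hyperbolic as soon as
`x` is. It remains to count the pairs `(x, y)` on this curve with `x` hyperbolic.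

Fix a finite field with `q` elements, of characteristic at least `5`, with quadratic character `χ`.
Detecting squares with `χ` shows that, if `N` is the number of pairs, then
`2 * N = q - 7 + A (1 - d ^ 2 / 4)` when `d ^ 2 ≠ 4`, where
`A l = ∑ x, χ (x * (x - 1) * (x - l))` is the character sum of the Legendre curve
`y ^ 2 = x * (x - 1) * (x - l)` (`two_mul_card_hyperbolicPairs`). When `d ^ 2 = 4` the curve
degenerates, and `N` is about twice as large.

Hasse's theorem would bound `A` by `2 * √q`, but much less is needed. The second moment of `A` over
all `l` can be computed exactly, `∑ l, A l ^ 2 = q ^ 2 - 2 * q - 1` (`sum_legendreSum_sq`), and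
`A l ^ 2` is unchanged under `l ↦ 1 - l` and `l ↦ l⁻¹`. Hence the same square occurs at least twice
in the sum, and `2 * A l ^ 2 ≤ q ^ 2 - 2 * q - 1` (`two_mul_legendreSum_sq_le`). This gives the claim
for every prime from `29` on. For `17`, `19` and `23` two pairs suffice, and these are found from the
parametrization `x = s + s⁻¹`, `y = t + t⁻¹` by a finite search.
-/

/-! ### Elementary sums of the quadratic character -/

section CharacterSums

theorem four_ne_zero_of_ringChar_ne_two {F : Type*} [Field F] (hF : ringChar F ≠ 2) :
    (4 : F) ≠ 0 := by
  have h : (4 : F) = 2 ^ 2 := by norm_num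
  rw [h]
  exact pow_ne_zero 2 (Ring.two_ne_zero hF)

variable {F : Type*} [Field F] [Fintype F] [DecidableEq F]

theorem quadraticChar_mul_self {a : F} (ha : a ≠ 0) :
    quadraticChar F a * quadraticChar F a = 1 := by
  rw [← sq, quadraticChar_sq_one ha]

theorem quadraticChar_four (hF : ringChar F ≠ 2) : quadraticChar F 4 = 1 := by
  have h : (4 : F) = 2 ^ 2 := by norm_num
  rw [h, quadraticChar_sq_one' (Ring.two_ne_zero hF)]

theorem sum_quadraticChar_sub (hF : ringChar F ≠ 2) (a : F) :
    ∑ x, quadraticChar F (x - a) = 0 := by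
  rw [← quadraticChar_sum_zero hF]
  exact Fintype.sum_equiv (Equiv.subRight a) _ _ fun _ => rfl

theorem sum_quadraticChar_sub_mul_self (a : F) :
    ∑ x, quadraticChar F (x - a) * quadraticChar F (x - a) = (Fintype.card F : ℤ) - 1 := by
  have h : ∀ x, quadraticChar F (x - a) * quadraticChar F (x - a) =
      1 - if x = a then (1 : ℤ) else 0 := by
    intro x
    split_ifs with hx
    · simp [hx]
    · rw [quadraticChar_mul_self (sub_ne_zero.mpr hx), sub_zero]
  simp [-quadraticChar_apply, h, Finset.sum_sub_distrib]

/-- An affine change of variable reduces this sum to the Jacobi sum of the quadratic character with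
itself. -/
theorem sum_quadraticChar_sub_mul_sub (hF : ringChar F ≠ 2) {a b : F} (hab : a ≠ b) :
    ∑ x, quadraticChar F (x - a) * quadraticChar F (x - b) = -1 := by
  have hba : b - a ≠ 0 := sub_ne_zero.mpr hab.symm
  have hJ := jacobiSum_nontrivial_inv (quadraticChar_ne_one hF)
  rw [(quadraticChar_isQuadratic F).inv, jacobiSum] at hJ
  have h : ∑ x, quadraticChar F (x - a) * quadraticChar F (x - b) =
      ∑ x, quadraticChar F (-1) * (quadraticChar F x * quadraticChar F (1 - x)) := by
    refine (Fintype.sum_equiv ((Equiv.mulLeft₀ (b - a) hba).trans (Equiv.addRight a))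
      _ _ fun x => ?_).symm
    have h1 : (b - a) * x + a - a = (b - a) * x := by ring
    have h2 : (b - a) * x + a - b = (b - a) * (-1 * (1 - x)) := by ring
    simp only [Equiv.trans_apply, Equiv.mulLeft₀_apply, Equiv.coe_addRight, h1, h2, map_mul]
    linear_combination -(quadraticChar F (-1) * quadraticChar F x * quadraticChar F (1 - x)) *
      quadraticChar_mul_self hba
  rw [h, ← Finset.mul_sum, hJ, mul_neg, quadraticChar_mul_self (neg_ne_zero.mpr one_ne_zero)]

/-- Each `a` has `1 + χ a` square roots. -/
theorem sum_comp_sq (hF : ringChar F ≠ 2) (f : F → ℤ) :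
    ∑ x, f (x ^ 2) = ∑ a, (1 + quadraticChar F a) * f a := by
  rw [← Finset.sum_fiberwise (Finset.univ : Finset F) (fun x => x ^ 2)]
  refine Finset.sum_congr rfl fun a _ => ?_
  rw [Finset.sum_congr rfl (g := fun _ => f a) (fun x hx => by rw [(Finset.mem_filter.mp hx).2]),
    Finset.sum_const, nsmul_eq_mul]
  have h := quadraticChar_card_sqrts hF a
  rw [Set.toFinset_ofPred] at h
  rw [h, add_comm]

/-! ### The character sums of Legendre curves -/

variable (F) in
/-- The sum of the quadratic character over the values of `x * (x - 1) * (x - l)`. For `l ≠ 0, 1`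
it is minus the trace of Frobenius of the Legendre curve with parameter `l`. -/
def legendreSum (l : F) : ℤ :=
  ∑ x, quadraticChar F x * quadraticChar F (x - 1) * quadraticChar F (x - l)

theorem sum_legendreSum_sq (hF : ringChar F ≠ 2) :
    ∑ l, legendreSum F l ^ 2 = (Fintype.card F : ℤ) ^ 2 - 2 * Fintype.card F - 1 := by
  set g : F → ℤ := fun x => quadraticChar F x * quadraticChar F (x - 1) with hg
  have hinner : ∀ x y : F, ∑ l, quadraticChar F (x - l) * quadraticChar F (y - l) =
      (if x = y then (Fintype.card F : ℤ) else 0) - 1 := by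
    intro x y
    have h : ∀ l, quadraticChar F (x - l) * quadraticChar F (y - l) =
        quadraticChar F (l - x) * quadraticChar F (l - y) := by
      intro l
      rw [← map_mul, ← map_mul]
      congr 1
      ring
    simp only [h]
    split_ifs with hxy
    · rw [hxy, sum_quadraticChar_sub_mul_self]
    · rw [sum_quadraticChar_sub_mul_sub hF hxy]
      norm_num
  have hg1 : ∑ x, g x = -1 := by
    have := sum_quadraticChar_sub_mul_sub hF (zero_ne_one (α := F))
    simpa [hg] using this
  have hg2 : ∑ x, g x * g x = (Fintype.card F : ℤ) - 2 := by
    have h : ∀ x, g x * g x = quadraticChar F (x - 0) * quadraticChar F (x - 0) -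
        if x = 1 then (1 : ℤ) else 0 := by
      intro x
      simp only [hg, sub_zero]
      split_ifs with hx
      · simp [hx]
      · linear_combination (quadraticChar F x * quadraticChar F x) *
          quadraticChar_mul_self (sub_ne_zero.mpr hx)
    simp only [h, Finset.sum_sub_distrib, sum_quadraticChar_sub_mul_self]
    simp
    ring
  calc ∑ l, legendreSum F l ^ 2
      = ∑ l, ∑ x, ∑ y, g x * g y * (quadraticChar F (x - l) * quadraticChar F (y - l)) := by
        refine Finset.sum_congr rfl fun l _ => ?_
        rw [sq, legendreSum, Finset.sum_mul_sum]
        refine Finset.sum_congr rfl fun x _ => Finset.sum_congr rfl fun y _ => ?_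
        simp only [hg]
        ring
    _ = ∑ x, ∑ y, g x * g y * ((if x = y then (Fintype.card F : ℤ) else 0) - 1) := by
        rw [Finset.sum_comm]
        refine Finset.sum_congr rfl fun x _ => ?_
        rw [Finset.sum_comm]
        refine Finset.sum_congr rfl fun y _ => ?_
        rw [← Finset.mul_sum, hinner]
    _ = Fintype.card F * ∑ x, g x * g x - (∑ x, g x) * ∑ y, g y := by
        rw [Finset.sum_mul_sum, Finset.mul_sum, ← Finset.sum_sub_distrib]
        refine Finset.sum_congr rfl fun x _ => ?_
        simp only [mul_sub, mul_one, mul_ite, mul_zero, Finset.sum_sub_distrib,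
          Finset.sum_ite_eq, Finset.mem_univ, if_true]
        ring
    _ = _ := by rw [hg1, hg2]; ring

theorem legendreSum_one_sub_sq (l : F) : legendreSum F (1 - l) ^ 2 = legendreSum F l ^ 2 := by
  have h : legendreSum F (1 - l) = quadraticChar F (-1) * legendreSum F l := by
    rw [legendreSum, legendreSum, Finset.mul_sum]
    refine Fintype.sum_equiv (Equiv.subLeft 1) _ _ fun x => ?_
    simp only [Equiv.subLeft_apply, ← map_mul]
    congr 1
    ring
  rw [h, mul_pow, quadraticChar_sq_one (neg_ne_zero.mpr one_ne_zero), one_mul]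

theorem legendreSum_inv_sq {l : F} (hl : l ≠ 0) :
    legendreSum F l⁻¹ ^ 2 = legendreSum F l ^ 2 := by
  have h : legendreSum F l = quadraticChar F l * legendreSum F l⁻¹ := by
    rw [legendreSum, legendreSum, Finset.mul_sum]
    refine (Fintype.sum_equiv (Equiv.mulLeft₀ l hl) _ _ fun x => ?_).symm
    have h1 : l * x - 1 = l * (x - l⁻¹) := by field_simp
    have h2 : l * x - l = l * (x - 1) := by ring
    simp only [Equiv.mulLeft₀_apply, h1, h2, map_mul]
    linear_combination -(quadraticChar F l * quadraticChar F x * quadraticChar F (x - 1) *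
      quadraticChar F (x - l⁻¹)) * quadraticChar_mul_self hl
  rw [h, mul_pow, quadraticChar_sq_one hl, one_mul]

/-- The exact second moment, together with the fact that the value at `l` is repeated, up to sign, at
`1 - l` or at `l⁻¹`, whichever differs from `l`. -/
theorem two_mul_legendreSum_sq_le (hF : ringChar F ≠ 2) (hF3 : ringChar F ≠ 3) (l : F) :
    2 * legendreSum F l ^ 2 ≤ (Fintype.card F : ℤ) ^ 2 - 2 * Fintype.card F - 1 := by
  obtain ⟨m, hm, hml⟩ : ∃ m, m ≠ l ∧ legendreSum F m ^ 2 = legendreSum F l ^ 2 := by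
    by_cases h : 1 - l = l
    · have hl : l ≠ 0 := by
        rintro rfl
        simp at h
      refine ⟨l⁻¹, fun hinv => ?_, legendreSum_inv_sq hl⟩
      -- `2 * l = 1` and `l ^ 2 = 1` together force `3 = 0`.
      have h1 : l * l = 1 := by
        nth_rewrite 1 [← hinv]
        exact inv_mul_cancel₀ hl
      have h3 : ((3 : ℕ) : F) = 0 := by
        push_cast
        linear_combination (-(1 : F) - 2 * l) * h - 4 * h1
      have := ringChar.dvd h3
      rcases (Nat.dvd_prime Nat.prime_three).mp this with h' | h'
      · exact CharP.ringChar_ne_one h'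
      · exact hF3 h'
    · exact ⟨1 - l, h, legendreSum_one_sub_sq l⟩
  calc 2 * legendreSum F l ^ 2 = ∑ i ∈ {m, l}, legendreSum F i ^ 2 := by
        rw [Finset.sum_pair hm, hml]
        ring
    _ ≤ ∑ i, legendreSum F i ^ 2 :=
        Finset.sum_le_sum_of_subset_of_nonneg (Finset.subset_univ _) fun _ _ _ => sq_nonneg _
    _ = _ := sum_legendreSum_sq hF

/-! ### Counting hyperbolic pairs -/

open Classical in
/-- The pairs `(x, y)` with `x` hyperbolic and `(x ^ 2 - 4) * (y ^ 2 - 4) = 4 * d ^ 2`. When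
`2 * d ≠ 0` the second entry is then hyperbolic too. -/
noncomputable def hyperbolicPairs (d : F) : Finset (F × F) :=
  {v | IsHyperbolic v.1 ∧ (v.1 ^ 2 - 4) * (v.2 ^ 2 - 4) = 4 * d ^ 2}

theorem card_filter_eq_one_add_quadraticChar (hF : ringChar F ≠ 2) {x : F} (d : F)
    (hx : IsHyperbolic x) :
    (({y | (x ^ 2 - 4) * (y ^ 2 - 4) = 4 * d ^ 2} : Finset F).card : ℤ) =
      1 + quadraticChar F (x ^ 2 - (4 - d ^ 2)) := by
  obtain ⟨h0, u, hu⟩ := hx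
  have hu0 : u ≠ 0 := by
    rintro rfl
    simp [hu] at h0
  have h2 : (2 : F) ≠ 0 := Ring.two_ne_zero hF
  have hset : ({y | (x ^ 2 - 4) * (y ^ 2 - 4) = 4 * d ^ 2} : Finset F) =
      ({y | y ^ 2 = (x ^ 2 - (4 - d ^ 2)) * (2 / u) ^ 2} : Finset F) := by
    ext y
    simp only [Finset.mem_filter, Finset.mem_univ, true_and]
    have h : x ^ 2 - (4 - d ^ 2) = u * u + d ^ 2 := by linear_combination hu
    rw [h, hu, div_pow, mul_div_assoc', eq_div_iff (pow_ne_zero 2 hu0)]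
    constructor <;> intro h' <;> linear_combination h'
  have h := quadraticChar_card_sqrts hF ((x ^ 2 - (4 - d ^ 2)) * (2 / u) ^ 2)
  rw [Set.toFinset_ofPred] at h
  rw [hset, h, map_mul, quadraticChar_sq_one' (div_ne_zero h2 hu0), mul_one, add_comm]

theorem two_mul_card_hyperbolicPairs_eq_sum (hF : ringChar F ≠ 2) {d : F} (hd : d ≠ 0) :
    2 * ((hyperbolicPairs d).card : ℤ) =
      ∑ x : F, (1 + quadraticChar F (x ^ 2 - 4)) * (1 + quadraticChar F (x ^ 2 - (4 - d ^ 2))) -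
        4 := by
  classical
  have hcard : ((hyperbolicPairs d).card : ℤ) =
      ∑ x, if IsHyperbolic x then 1 + quadraticChar F (x ^ 2 - (4 - d ^ 2)) else 0 := by
    rw [hyperbolicPairs, Finset.card_filter, Fintype.sum_prod_type, Nat.cast_sum]
    refine Finset.sum_congr rfl fun x _ => ?_
    split_ifs with hx
    · rw [← card_filter_eq_one_add_quadraticChar hF d hx, Finset.card_filter]
      simp [hx]
    · simp [hx]
  have hfour : ∑ x : F, (if x ^ 2 = 4 then (2 : ℤ) else 0) = 4 := by
    rw [sum_comp_sq hF fun a => if a = 4 then (2 : ℤ) else 0]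
    simp [-quadraticChar_apply, quadraticChar_four hF]
  rw [hcard, Finset.mul_sum]
  conv_rhs => rw [← hfour]
  rw [← Finset.sum_sub_distrib]
  refine Finset.sum_congr rfl fun x _ => ?_
  by_cases hx : x ^ 2 = 4
  · have h : x ^ 2 - (4 - d ^ 2) = d ^ 2 := by rw [hx]; ring
    rw [if_neg (fun h' : IsHyperbolic x => h'.1 (sub_eq_zero.mpr hx)), if_pos hx, h,
      quadraticChar_sq_one' hd, hx]
    simp
  · have h0 : x ^ 2 - 4 ≠ 0 := sub_ne_zero.mpr hx
    by_cases hsq : IsSquare (x ^ 2 - 4)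
    · rw [if_pos ⟨h0, hsq⟩, if_neg hx, (quadraticChar_one_iff_isSquare h0).mpr hsq]
      ring
    · rw [if_neg (fun h' : IsHyperbolic x => hsq h'.2), if_neg hx,
        quadraticChar_neg_one_iff_not_isSquare.mpr hsq]
      ring

theorem sum_quadraticChar_eq_legendreSum (hF : ringChar F ≠ 2) (e : F) :
    ∑ x, quadraticChar F x * quadraticChar F (x - 4) * quadraticChar F (x - e) =
      legendreSum F (e / 4) := by
  have h4 := four_ne_zero_of_ringChar_ne_two hF
  rw [legendreSum]
  refine (Fintype.sum_equiv (Equiv.mulLeft₀ 4 h4) _ _ fun x => ?_).symm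
  have h1 : 4 * x - 4 = 4 * (x - 1) := by ring
  have h3 : 4 * x - e = 4 * (x - e / 4) := by field_simp
  simp only [Equiv.mulLeft₀_apply, h1, h3, map_mul, quadraticChar_four hF, one_mul]

/-- The last term accounts for the degenerate curve `d ^ 2 = 4`. -/
theorem two_mul_card_hyperbolicPairs (hF : ringChar F ≠ 2) {d : F} (hd : d ≠ 0) :
    2 * ((hyperbolicPairs d).card : ℤ) =
      Fintype.card F - 7 + legendreSum F ((4 - d ^ 2) / 4) +
        if 4 - d ^ 2 = 0 then (Fintype.card F : ℤ) else 0 := by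
  have h4 := four_ne_zero_of_ringChar_ne_two hF
  have he : (4 : F) ≠ 4 - d ^ 2 := fun h => pow_ne_zero 2 hd (by linear_combination h)
  rw [two_mul_card_hyperbolicPairs_eq_sum hF hd]
  set e := 4 - d ^ 2
  rw [sum_comp_sq hF fun a => (1 + quadraticChar F (a - 4)) * (1 + quadraticChar F (a - e)),
    ← sum_quadraticChar_eq_legendreSum hF e]
  have hexp : ∀ a : F, (1 + quadraticChar F a) *
      ((1 + quadraticChar F (a - 4)) * (1 + quadraticChar F (a - e))) =
      1 + quadraticChar F a + quadraticChar F (a - 4) + quadraticChar F (a - e) +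
      quadraticChar F (a - 0) * quadraticChar F (a - 4) +
      quadraticChar F (a - 0) * quadraticChar F (a - e) +
      quadraticChar F (a - 4) * quadraticChar F (a - e) +
      quadraticChar F a * quadraticChar F (a - 4) * quadraticChar F (a - e) := by
    intro a
    rw [sub_zero]
    ring
  have h0e : ∑ a, quadraticChar F (a - 0) * quadraticChar F (a - e) =
      (if e = 0 then (Fintype.card F : ℤ) else 0) - 1 := by
    split_ifs with h
    · rw [h, sum_quadraticChar_sub_mul_self]
    · rw [sum_quadraticChar_sub_mul_sub hF (Ne.symm h)]
      norm_num
  simp only [hexp, Finset.sum_add_distrib]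
  rw [h0e, sum_quadraticChar_sub_mul_sub hF he, sum_quadraticChar_sub_mul_sub hF h4.symm,
    sum_quadraticChar_sub hF, sum_quadraticChar_sub hF, quadraticChar_sum_zero hF]
  simp
  ring

/-- With `x = s + s⁻¹` and `y = t + t⁻¹`, the pairs `(x, y)` and `(-x, y)` both belong to
`hyperbolicPairs d`; they are distinct because `s ^ 2 + 1 ≠ 0`. -/
theorem two_le_card_hyperbolicPairs (hF : ringChar F ≠ 2) {d s t : F} (hd : d ≠ 0) (hs : s ≠ 0)
    (ht : t ≠ 0) (hs1 : s ^ 2 + 1 ≠ 0) (h : (s ^ 2 - 1) * (t ^ 2 - 1) = 2 * d * s * t) :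
    2 ≤ (hyperbolicPairs d).card := by
  have h2 : (2 : F) ≠ 0 := Ring.two_ne_zero hF
  have hne : s ^ 2 - 1 ≠ 0 := by
    intro h'
    rw [h', zero_mul] at h
    exact mul_ne_zero (mul_ne_zero (mul_ne_zero h2 hd) hs) ht h.symm
  have hx4 : (s + s⁻¹) ^ 2 - 4 = (s - s⁻¹) * (s - s⁻¹) := by
    field_simp
    ring
  have hu : s - s⁻¹ ≠ 0 := by
    have : s - s⁻¹ = (s ^ 2 - 1) / s := by field_simp
    rw [this]
    exact div_ne_zero hne hs
  have hx0 : s + s⁻¹ ≠ 0 := by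
    have : s + s⁻¹ = (s ^ 2 + 1) / s := by field_simp
    rw [this]
    exact div_ne_zero hs1 hs
  have hyp : IsHyperbolic (s + s⁻¹) := by
    refine ⟨?_, s - s⁻¹, hx4⟩
    rw [hx4]
    exact mul_ne_zero hu hu
  have heq : ((s + s⁻¹) ^ 2 - 4) * ((t + t⁻¹) ^ 2 - 4) = 4 * d ^ 2 := by
    have huv : (s - s⁻¹) * (t - t⁻¹) = 2 * d := by
      field_simp
      linear_combination h
    have hy4 : (t + t⁻¹) ^ 2 - 4 = (t - t⁻¹) * (t - t⁻¹) := by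
      field_simp
      ring
    rw [hx4, hy4]
    linear_combination ((s - s⁻¹) * (t - t⁻¹) + 2 * d) * huv
  have hsub : {(s + s⁻¹, t + t⁻¹), (-(s + s⁻¹), t + t⁻¹)} ⊆ hyperbolicPairs d := by
    intro v hv
    simp only [Finset.mem_insert, Finset.mem_singleton] at hv
    rcases hv with rfl | rfl
    · simp only [hyperbolicPairs, Finset.mem_filter, Finset.mem_univ, true_and]
      exact ⟨hyp, heq⟩
    · simp only [hyperbolicPairs, Finset.mem_filter, Finset.mem_univ, true_and]
      rw [IsHyperbolic, neg_sq]
      exact ⟨hyp, heq⟩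
  refine le_trans (le_of_eq ?_) (Finset.card_le_card hsub)
  rw [Finset.card_pair]
  intro h'
  have h1 := (Prod.mk.inj h').1
  refine mul_ne_zero h2 hx0 ?_
  linear_combination h1

end CharacterSums

/-! ### Prime fields -/

set_option maxRecDepth 100000 in
theorem exists_param_of_small_prime (p : ℕ) (hp : p = 17 ∨ p = 19 ∨ p = 23)
    (d : ZMod p) (hd : d ≠ 0) :
    ∃ s t : ZMod p, (s ^ 2 - 1) * (t ^ 2 - 1) = 2 * d * s * t ∧ s ≠ 0 ∧ t ≠ 0 ∧
      s ^ 2 + 1 ≠ 0 := by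
  rcases hp with rfl | rfl | rfl <;> revert d <;> decide

theorem le_sixteen_mul_card_hyperbolicPairs (p : ℕ) [Fact p.Prime] (hp : 17 ≤ p) (d : ZMod p)
    (hd : d ≠ 0) : p ≤ 16 * (hyperbolicPairs d).card := by
  have hchar : ringChar (ZMod p) = p := ZMod.ringChar_zmod_n p
  have hF : ringChar (ZMod p) ≠ 2 := by omega
  by_cases hsmall : p = 17 ∨ p = 19 ∨ p = 23
  · obtain ⟨s, t, h, hs, ht, hs1⟩ := exists_param_of_small_prime p hsmall d hd
    have := two_le_card_hyperbolicPairs hF hd hs ht hs1 h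
    omega
  have hp29 : 29 ≤ p := by
    by_contra hlt
    have hprime : p.Prime := Fact.out
    interval_cases p <;> first | omega | (revert hprime; norm_num)
  have hA := two_mul_legendreSum_sq_le hF (by omega) ((4 - d ^ 2) / 4)
  have hN := two_mul_card_hyperbolicPairs hF hd
  rw [ZMod.card] at hA hN
  set A := legendreSum (ZMod p) ((4 - d ^ 2) / 4)
  by_contra hlt
  have hlt' : 16 * ((hyperbolicPairs d).card : ℤ) ≤ p - 1 := by omega
  have hA8 : 8 * A ≤ -7 * p + 55 := by
    split_ifs at hN <;> omega
  have hp29' : (29 : ℤ) ≤ p := by exact_mod_cast hp29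
  have hsq : (7 * (p : ℤ) - 55) ^ 2 ≤ (8 * A) ^ 2 := by nlinarith
  -- For `p ≥ 37` the two bounds on `A ^ 2` contradict each other outright. Below that, the
  -- integrality of `A` and of the number of pairs has to be used.
  have hp37 : p < 37 := by
    by_contra h37
    have : (37 : ℤ) ≤ p := by exact_mod_cast not_lt.mp h37
    nlinarith
  have hcard : (hyperbolicPairs d).card ≤ 2 := by omega
  have hprime : p.Prime := Fact.out
  have hp31 : (p = 29 ∨ p = 31) := by
    clear_value A
    clear hA hN hlt hlt' hA8 hsq hcard hd A d hchar hF
    interval_cases p <;> first | omega | (revert hprime; norm_num)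
  have hA9 : A ≤ 9 - p := by
    split_ifs at hN <;> omega
  rcases hp31 with h | h <;> rw [h] at hA hA9 <;> push_cast at hA hA9 <;> nlinarith

theorem mainTheorem8 (p : ℕ) [Fact p.Prime] (hp : 17 ≤ p) (k : ZMod p)
    (hk : 2 - k ≠ 0 ∧ IsSquare (2 - k)) :
    (p : ℝ) / 16 ≤
      (({(x, y, z) : ZMod p × ZMod p × ZMod p |
          (x, y, z) ∈ markoffSolutions k ∧ IsHyperbolic x ∧ IsHyperbolic y ∧
            x * y - z = z}.ncard : ℕ) : ℝ) := by
  obtain ⟨hk0, d, hd⟩ := hk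
  have hd0 : d ≠ 0 := by
    rintro rfl
    simp [hd] at hk0
  have hF : ringChar (ZMod p) ≠ 2 := by
    rw [ZMod.ringChar_zmod_n]
    omega
  have h2 : (2 : ZMod p) ≠ 0 := Ring.two_ne_zero hF
  have hle := le_sixteen_mul_card_hyperbolicPairs p hp d hd0
  set S : Set (ZMod p × ZMod p × ZMod p) := {(x, y, z) |
    (x, y, z) ∈ markoffSolutions k ∧ IsHyperbolic x ∧ IsHyperbolic y ∧ x * y - z = z}
  have hcard : (hyperbolicPairs d).card ≤ S.ncard := by
    rw [← Set.ncard_coe_finset]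
    refine Set.ncard_le_ncard_of_injOn (fun v => (v.1, v.2, v.1 * v.2 / 2)) ?_ ?_ S.toFinite
    · rintro ⟨x, y⟩ hv
      simp only [hyperbolicPairs, Finset.coe_filter, Finset.mem_univ, true_and,
        Set.mem_ofPred_eq] at hv
      obtain ⟨hx, hxy⟩ := hv
      refine ⟨?_, hx, ?_, ?_⟩
      · change x ^ 2 + y ^ 2 + (x * y / 2) ^ 2 - x * y * (x * y / 2) - 2 = k
        field_simp
        linear_combination -hxy + 4 * hd
      · obtain ⟨hx0, u, hu⟩ := hx
        have hu0 : u ≠ 0 := by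
          rintro rfl
          simp [hu] at hx0
        have hy : y ^ 2 - 4 = (2 * d / u) * (2 * d / u) := by
          rw [hu] at hxy
          field_simp
          linear_combination hxy
        refine ⟨?_, _, hy⟩
        rw [hy]
        exact mul_self_ne_zero.mpr (div_ne_zero (mul_ne_zero h2 hd0) hu0)
      · change x * y - x * y / 2 = x * y / 2
        field_simp
        ring
    · rintro ⟨x, y⟩ _ ⟨x', y'⟩ _ h
      simp only [Prod.mk.injEq] at h
      exact Prod.ext h.1 h.2.1
  have hfin : (p : ℝ) ≤ 16 * (S.ncard : ℝ) := by
    exact_mod_cast hle.trans (Nat.mul_le_mul_left 16 hcard)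
  linarith
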